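/- Let $T>0$, $d,m\in\mathbb N$, $H\in(\tfrac12,1)$, and let $W=(W^1,\dots,W^m)$ be independent fractional Brownian motions with Hurst parameter $H$ on a probability space $(\Omega,\mathcal F,P)$, i.e. each $W^j=(W^j_t)_{t\ge0}$ is a centred Gaussian process with covariance $\tfrac12\big(t^{2H}+s^{2H}-|t-s|^{2H}\big)$. Let $x_0\in\mathbb R^d$ with $x_0^i>0$ for all $i$, and let $\sigma:[0,T]\times\mathbb R^d\to\mathbb R^{d\times m}$ and $b:[0,T]\times\mathbb R^d\to\mathbb R^d$ satisfy, for some $\nu\ge H$: (H1) $\sigma$ is bounded and there is $K_0$ with $|\sigma(t,x)-\sigma(t,y)|\le K_0|x-y|$ and $|\sigma(t,x)-\sigma(s,x)|\le K_0|t-s|^{\nu}$ for all $s,t\in[0,T]$, $x,y\in\mathbb R^d$; (H2) $b$ is bounded and there is $K_0$ with $|b(t,x)-b(t,y)|\le K_0|x-y|$ for all $t\in[0,T]$, $x,y\in\mathbb R^d$. Let $X=(X(t))_{t\in[0,T]}$ be an $\mathbb R^d$-valued process which solves the equation with normal reflection $$X(t)=Z(t)+Y(t),\qquad Z(t)=x_0+\int_0^t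 b(s,X(s))\,ds+\int_0^t\sigma(s,X(s))\,dW_s,\qquad Y^i(t)=\max_{s\in[0,t]}\big(Z^i(s)\big)^-,$$ for $t\in[0,T]$, $i=1,\dots,d$, almost surely, where the first integral is a Lebesgue integral and the second a pathwise Young integral, both being assumed to exist. Here a Young integral $\int_s^t f\,dg$ is understood for $f$ $\kappa$-Hölder and $g$ $\gamma$-Hölder on $[0,T]$ with $\kappa,\gamma\in(0,1]$ and $\kappa+\gamma>1$; it is $f_s(g_t-g_s)+R_{st}$, where $R$ is the unique function on $[0,T]^2$ with $|R_{st}|\le C|t-s|^{\mu}$ for some $C$ and some $\mu>1$ and $R_{st}-R_{su}-R_{ut}=(f_u-f_s)(g_t-g_u)$ for all $s,u,t\in[0,T]$. Then for every $\lambda_0\in(\tfrac12,H)$ the Hölder norm $$\|X\|_{\lambda_0,[0,T]}=\sup_{0\le u<v\le T}\frac{|X(v)-X(u)|}{(v-u)^{\lambda_0}}$$ is a random variable (up to a null set), and $$E\big(\|X\|_{\lambda_0,[0,T]}^p\big)<\infty\qquad\text{for all }p\ge1.$$ -/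

import Mathlib

open MeasureTheory ProbabilityTheory Set
open scoped NNReal ENNReal Matrix.Norms.Frobenius

/-- A fractional Brownian motion with Hurst parameter `H`: a centred Gaussian process with
covariance `(t ^ (2H) + s ^ (2H) - |t - s| ^ (2H)) / 2`. No path regularity is imposed, so every
version of the process is covered. -/
structure IsFractionalBrownianMotion {Ω : Type*} [MeasurableSpace Ω] (P : Measure Ω) (H : ℝ)
    (B : ℝ≥0 → Ω → ℝ) : Prop where
  gaussian : IsGaussianProcess B P
  centered : ∀ t, ∫ ω, B t ω ∂P = 0
  covariance_eq : ∀ s t, cov[B s, B t; P] =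
    ((t : ℝ) ^ (2 * H) + (s : ℝ) ^ (2 * H) - |(t : ℝ) - (s : ℝ)| ^ (2 * H)) / 2

/-- The trajectory `t ↦ (W¹_t(ω), …, Wᵐ_t(ω))`, `t ≥ 0`, as a function of a real variable. -/
noncomputable def noisePath {Ω : Type*} {m : ℕ} (W : Fin m → ℝ≥0 → Ω → ℝ) (ω : Ω) :
    ℝ → EuclideanSpace ℝ (Fin m) :=
  fun t => WithLp.toLp 2 fun j => W j t.toNNReal ω

/-- The `r`-Hölder (semi)norm `sup_{a ≤ u < v ≤ b} |f v - f u| / (v - u) ^ r`, with values in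
`[0, ∞]`. -/
noncomputable def holderNormOn {E : Type*} [NormedAddCommGroup E] (r a b : ℝ) (f : ℝ → E) :
    ℝ≥0∞ :=
  ⨆ (u : ℝ) (v : ℝ) (_ : a ≤ u ∧ u < v ∧ v ≤ b), ENNReal.ofReal (‖f v - f u‖ / (v - u) ^ r)

/-- `A v` for a matrix `A` and a vector `v` of Euclidean space. -/
noncomputable def matVec {d m : ℕ} (A : Matrix (Fin d) (Fin m) ℝ)
    (v : EuclideanSpace ℝ (Fin m)) : EuclideanSpace ℝ (Fin d) :=
  A.toEuclideanLin v

/-- `R` is the increment `Λ(δf δg)` on `[0,T]`: a 2-increment of order `μ > 1` whose coboundary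
`(δR)_{sut} = R_{st} - R_{su} - R_{ut}` is `(f_u - f_s) (g_t - g_u)`. At most one `R` has these
properties on `[0,T]²`, and for continuous `f`, `g` it is continuous. -/
structure IsSewingOf {d m : ℕ} (T : ℝ) (f : ℝ → Matrix (Fin d) (Fin m) ℝ)
    (g : ℝ → EuclideanSpace ℝ (Fin m)) (R : ℝ → ℝ → EuclideanSpace ℝ (Fin d)) : Prop where
  order : ∃ μ : ℝ, 1 < μ ∧ ∃ C : ℝ, ∀ s ∈ Icc 0 T, ∀ t ∈ Icc 0 T, ‖R s t‖ ≤ C * |t - s| ^ μ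
  coboundary : ∀ s ∈ Icc 0 T, ∀ u ∈ Icc 0 T, ∀ t ∈ Icc 0 T,
    R s t - R s u - R u t = matVec (f u - f s) (g t - g u)

/-- `J s t` is the Young integral `∫_s^t f dg` for all `s, t ∈ [0,T]`: `f` is `κ`-Hölder and `g`
is `γ`-Hölder with `κ + γ > 1`, and `∫_s^t f dg = f_s (g_t - g_s) + Λ_{st}(δf δg)`. -/
structure IsYoungIntegral {d m : ℕ} (T : ℝ) (f : ℝ → Matrix (Fin d) (Fin m) ℝ)
    (g : ℝ → EuclideanSpace ℝ (Fin m)) (J : ℝ → ℝ → EuclideanSpace ℝ (Fin d)) : Prop where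
  regular : ∃ κ ∈ Ioc (0 : ℝ) 1, ∃ γ ∈ Ioc (0 : ℝ) 1, 1 < κ + γ ∧
    holderNormOn κ 0 T f < ∞ ∧ holderNormOn γ 0 T g < ∞
  eq : ∃ R, IsSewingOf T f g R ∧
    ∀ s ∈ Icc 0 T, ∀ t ∈ Icc 0 T, J s t = matVec (f s) (g t - g s) + R s t

/-- `x` solves on `[0,T]` the equation with normal reflection
`x(t) = x₀ + ∫₀ᵗ b(s,x(s)) ds + ∫₀ᵗ σ(s,x(s)) dg_s + y(t)`, where `yⁱ(t) = max_{s ≤ t} (zⁱ(s))⁻`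
and `z` is the right-hand side without `y`; both integrals are required to exist. -/
def IsReflectedSolution {d m : ℕ} (T : ℝ) (x₀ : EuclideanSpace ℝ (Fin d))
    (b : ℝ → EuclideanSpace ℝ (Fin d) → EuclideanSpace ℝ (Fin d))
    (σ : ℝ → EuclideanSpace ℝ (Fin d) → Matrix (Fin d) (Fin m) ℝ)
    (g : ℝ → EuclideanSpace ℝ (Fin m)) (x : ℝ → EuclideanSpace ℝ (Fin d)) : Prop :=
  IntegrableOn (fun s => b s (x s)) (Icc 0 T) ∧
  ∃ (J : ℝ → ℝ → EuclideanSpace ℝ (Fin d)) (z y : ℝ → EuclideanSpace ℝ (Fin d)),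
    IsYoungIntegral T (fun s => σ s (x s)) g J ∧
    (∀ t ∈ Icc 0 T, z t = x₀ + (∫ s in (0 : ℝ)..t, b s (x s)) + J 0 t) ∧
    (∀ t ∈ Icc 0 T, ∀ i, IsGreatest ((fun s => (z s i)⁻) '' Icc 0 t) (y t i)) ∧
    ∀ t ∈ Icc 0 T, x t = z t + y t

/-- The process `X` solves the reflected equation driven by `W`: each `X t`, `t ∈ [0,T]`, is a
random variable and almost every trajectory solves the equation driven by that of `W`. -/
def IsStochasticReflectedSolution {Ω : Type*} [MeasurableSpace Ω] (P : Measure Ω) {d m : ℕ}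
    (T : ℝ) (x₀ : EuclideanSpace ℝ (Fin d))
    (b : ℝ → EuclideanSpace ℝ (Fin d) → EuclideanSpace ℝ (Fin d))
    (σ : ℝ → EuclideanSpace ℝ (Fin d) → Matrix (Fin d) (Fin m) ℝ)
    (W : Fin m → ℝ≥0 → Ω → ℝ) (X : ℝ → Ω → EuclideanSpace ℝ (Fin d)) : Prop :=
  (∀ t ∈ Icc 0 T, AEMeasurable (X t) P) ∧
  ∀ᵐ ω ∂P, IsReflectedSolution T x₀ b σ (noisePath W ω) (fun t => X t ω)

/-- Hypothesis on the diffusion coefficient: bounded, Lipschitz in space and `ν`-Hölder in time on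
`[0,T]`. The norm of a matrix is the Euclidean (Frobenius) one. -/
def HypSigma {d m : ℕ} (T ν : ℝ)
    (σ : ℝ → EuclideanSpace ℝ (Fin d) → Matrix (Fin d) (Fin m) ℝ) : Prop :=
  (∃ K, ∀ t ∈ Icc 0 T, ∀ x, ‖σ t x‖ ≤ K) ∧
  ∃ K₀ : ℝ, (∀ t ∈ Icc 0 T, ∀ x y, ‖σ t x - σ t y‖ ≤ K₀ * ‖x - y‖) ∧
    ∀ x, ∀ t ∈ Icc 0 T, ∀ s ∈ Icc 0 T, ‖σ t x - σ s x‖ ≤ K₀ * |t - s| ^ ν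

/-- Hypothesis on the drift: bounded and Lipschitz in space on `[0,T]`. -/
def HypDrift {d : ℕ} (T : ℝ)
    (b : ℝ → EuclideanSpace ℝ (Fin d) → EuclideanSpace ℝ (Fin d)) : Prop :=
  (∃ K, ∀ t ∈ Icc 0 T, ∀ x, ‖b t x‖ ≤ K) ∧
  ∃ K₀ : ℝ, ∀ t ∈ Icc 0 T, ∀ x y, ‖b t x - b t y‖ ≤ K₀ * ‖x - y‖

/-! The estimate is pathwise: if the driving path `g` is `r`-Hölder on `[0,T]` with constant `M`,
where `1/2 < r`, then a solution is `r`-Hölder with constant at most `C * (1 + M) ^ 3`, `C`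
depending only on the coefficients, `T`, `r`, `ν` and the dimension. The moments then come from
those of the noise.

Pathwise part. Over a time step the reflection term moves no more than the oscillation of `z`, so
passing from `z` to `x` costs only a factor `1 + d` (`HolderAtScale.add_reflection`). In the Young
integral the first-order term is at most `K * M` times the step to the power `r`, because `σ` is
bounded. The solution's own Hölder constant `L` enters only through the sewing remainder, which has
order `2 * r` (`IsSewingOf.norm_le`). On steps of length at most `δ` that remainder carries an extra
factor `δ ^ r`. With `δ ^ r` of order `1 / (1 + M)` an admissible `L` improves to `D * (1 + M) + L /
2`, and iteration gives `2 * D * (1 + M)`. Covering `[0,T]` takes about `T / δ` steps, of order at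
most `(1 + M) ^ 2` since `1 / r ≤ 2`; hence the cube.

Probabilistic part. For large `q`, a sum of `q`-th powers of dyadic increments, with weights tuned
to the exponent `r < H`, has finite expectation by Gaussian scaling, and by chaining its `1 / q`-th
power dominates the Hölder constant of a continuous path. Continuity need not be assumed of the
fractional Brownian motion: existence of the Young integral forces it. Taking `q ≥ 3 * p` makes the
`p`-th power of the cubic bound grow at most linearly in an integrable variable. -/

/-! ### Hölder continuity at a given scale -/

/-- `f` is `r`-Hölder on `[0,T]` with constant `C` for pairs of points at distance at most `δ`. -/
def HolderAtScale {E : Type*} [NormedAddCommGroup E] (r T δ C : ℝ) (f : ℝ → E) : Prop :=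
  ∀ u ∈ Icc 0 T, ∀ v ∈ Icc 0 T, u ≤ v → v - u ≤ δ → ‖f v - f u‖ ≤ C * (v - u) ^ r

theorem HolderAtScale.mono_const {E : Type*} [NormedAddCommGroup E] {r T δ C C' : ℝ} {f : ℝ → E}
    (hf : HolderAtScale r T δ C f) (h : C ≤ C') : HolderAtScale r T δ C' f := by
  intro u hu v hv huv hδ
  refine (hf u hu v hv huv hδ).trans ?_
  have : 0 ≤ v - u := by linarith
  gcongr

theorem HolderAtScale.of_le {E : Type*} [NormedAddCommGroup E] {r T δ C : ℝ} {f : ℝ → E}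
    (hf : HolderAtScale r T T C f) : HolderAtScale r T δ C f :=
  fun u hu v hv huv _ => hf u hu v hv huv (by linarith [hu.1, hv.2])

/-- Chaining: a Hölder estimate at scale `δ` extends to all scales, the constant being multiplied
by the number of steps. -/
theorem HolderAtScale.chain {E : Type*} [NormedAddCommGroup E] {r T δ C : ℝ} {f : ℝ → E}
    (hf : HolderAtScale r T δ C f) (hr : 0 ≤ r) (hC : 0 ≤ C) {N : ℕ} (hN : 1 ≤ N)
    (hT : T ≤ N * δ) : HolderAtScale r T T (N * C) f := by
  intro u hu v hv huv _
  have hN0 : (0 : ℝ) < N := by exact_mod_cast hN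
  have hN1 : (1 : ℝ) ≤ N := by exact_mod_cast hN
  set h : ℝ := (v - u) / N with hh
  have hhN : N * h = v - u := by rw [hh]; field_simp
  have hh0 : 0 ≤ h := div_nonneg (by linarith) hN0.le
  have hhv : h ≤ v - u := by nlinarith
  have hhδ : h ≤ δ := by
    rw [hh, div_le_iff₀ hN0]; linarith [hu.1, hv.2]
  have key : ∀ k : ℕ, k ≤ N → ‖f (u + k * h) - f u‖ ≤ k * (C * h ^ r) := by
    intro k
    induction k with
    | zero => simp
    | succ k ih =>
      intro hk
      have hk' : (k : ℝ) + 1 ≤ N := by exact_mod_cast hk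
      have h1 := ih (by omega)
      have hk0 : (0 : ℝ) ≤ k * h := by positivity
      have hle : (k + 1) * h ≤ v - u := by rw [← hhN]; gcongr
      have h2 := hf (u + k * h) ⟨by linarith [hu.1], by linarith [hv.2]⟩
        (u + (k + 1) * h) ⟨by linarith [hu.1], by linarith [hv.2]⟩ (by linarith) (by linarith)
      have h3 : u + (k + 1) * h - (u + k * h) = h := by ring
      rw [h3] at h2
      push_cast
      calc ‖f (u + (k + 1) * h) - f u‖
          = ‖(f (u + (k + 1) * h) - f (u + k * h)) + (f (u + k * h) - f u)‖ := by congr 1; abel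
        _ ≤ C * h ^ r + k * (C * h ^ r) := (norm_add_le _ _).trans (add_le_add h2 h1)
        _ = (k + 1) * (C * h ^ r) := by ring
  have h1 := key N le_rfl
  rw [hhN, add_sub_cancel] at h1
  calc ‖f v - f u‖ ≤ N * (C * h ^ r) := h1
    _ ≤ N * (C * (v - u) ^ r) := by gcongr
    _ = N * C * (v - u) ^ r := by ring

/-- If every admissible constant `L` can be improved to `A + L / 2`, then `2 A` is admissible. -/
theorem HolderAtScale.of_contraction {E : Type*} [NormedAddCommGroup E] {r T δ A L : ℝ}
    {f : ℝ → E} (hA : 0 ≤ A) (hL : 0 ≤ L) (hf : HolderAtScale r T δ L f)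
    (step : ∀ L, 0 ≤ L → HolderAtScale r T δ L f → HolderAtScale r T δ (A + L / 2) f) :
    HolderAtScale r T δ (2 * A) f := by
  -- The excess over the fixed point `2 * A` of `L ↦ A + L / 2` is halved at each step.
  have key : ∀ n : ℕ, HolderAtScale r T δ (2 * A + (1 / 2) ^ n * L) f := by
    intro n
    induction n with
    | zero => exact hf.mono_const (by simp; linarith)
    | succ n ih =>
      refine (step _ (by positivity) ih).mono_const (le_of_eq ?_)
      rw [pow_succ]; ring
  intro u hu v hv huv hδ
  have hlim : Filter.Tendsto (fun n : ℕ => (2 * A + (1 / 2 : ℝ) ^ n * L) * (v - u) ^ r)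
      Filter.atTop (nhds ((2 * A + 0 * L) * (v - u) ^ r)) :=
    (((tendsto_pow_atTop_nhds_zero_of_lt_one (by norm_num) (by norm_num)).mul_const L).const_add
      _).mul_const _
  have := ge_of_tendsto' hlim fun n => key n u hu v hv huv hδ
  simpa using this

/-! ### The sewing estimate -/

/-- A vector is a one-column matrix, and the Frobenius norm is submultiplicative. -/
theorem norm_matVec_le {d m : ℕ} (A : Matrix (Fin d) (Fin m) ℝ) (v : EuclideanSpace ℝ (Fin m)) :
    ‖matVec A v‖ ≤ ‖A‖ * ‖v‖ := by
  have h := Matrix.frobenius_norm_mul A (Matrix.replicateCol Unit v.ofLp)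
  rw [← Matrix.replicateCol_mulVec, Matrix.frobenius_norm_replicateCol,
    Matrix.frobenius_norm_replicateCol] at h
  exact h

theorem two_rpow_one_sub_lt_one {a : ℝ} (ha : 1 < a) : (2 : ℝ) ^ (1 - a) < 1 :=
  Real.rpow_lt_one_of_one_lt_of_neg (by norm_num) (by linarith)

theorem two_mul_half_rpow {h : ℝ} (hh : 0 ≤ h) (a : ℝ) :
    2 * (h / 2) ^ a = 2 ^ (1 - a) * h ^ a := by
  rw [Real.div_rpow hh (by norm_num), Real.rpow_sub (by norm_num), Real.rpow_one]
  ring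

/-- The sewing estimate: the constant does not depend on the a priori order of `R`. -/
theorem IsSewingOf.norm_le {d m : ℕ} {T r δ F M : ℝ} {f : ℝ → Matrix (Fin d) (Fin m) ℝ}
    {g : ℝ → EuclideanSpace ℝ (Fin m)} {R : ℝ → ℝ → EuclideanSpace ℝ (Fin d)}
    (hR : IsSewingOf T f g R) (hr : 1 / 2 < r) (hF : 0 ≤ F) (hM : 0 ≤ M)
    (hf : HolderAtScale r T δ F f) (hg : HolderAtScale r T δ M g)
    {s t : ℝ} (hs : s ∈ Icc 0 T) (ht : t ∈ Icc 0 T) (hst : s ≤ t) (hδ : t - s ≤ δ) :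
    ‖R s t‖ ≤ (1 - 2 ^ (1 - 2 * r))⁻¹ * (F * M) * (t - s) ^ (2 * r) := by
  obtain ⟨μ, hμ, C, hC⟩ := hR.order
  have hθ : (2 : ℝ) ^ (1 - 2 * r) < 1 := two_rpow_one_sub_lt_one (by linarith)
  set θ : ℝ := 2 ^ (1 - 2 * r) with hθdef
  set ρ : ℝ := 2 ^ (1 - μ) with hρdef
  set B : ℝ := (1 - θ)⁻¹ * (F * M) with hB
  -- `B` is the fixed point of the recursion that halving an interval imposes on the coefficient of
  -- `(t - s) ^ (2 * r)`.
  have hBeq : B = θ * B + F * M := by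
    have : (1 - θ) ≠ 0 := by linarith
    rw [hB]; field_simp; ring
  -- Bisecting `n` times shrinks the a priori term by `ρ ^ n`, with `ρ < 1` because `μ > 1`. It
  -- disappears in the limit, so neither `μ` nor `C` survives in the bound.
  have key : ∀ n : ℕ, ∀ s ∈ Icc 0 T, ∀ t ∈ Icc 0 T, s ≤ t → t - s ≤ δ →
      ‖R s t‖ ≤ C * ρ ^ n * (t - s) ^ μ + B * (t - s) ^ (2 * r) := by
    intro n
    induction n with
    | zero =>
      intro s hs t ht hst _
      have h0 : 0 ≤ t - s := by linarith
      have h1 := hC s hs t ht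
      rw [abs_of_nonneg h0] at h1
      have h2 : 0 ≤ B * (t - s) ^ (2 * r) := by
        have : 0 < 1 - θ := by linarith
        rw [hB]; positivity
      simpa using h1.trans (le_add_of_nonneg_right h2)
    | succ n ih =>
      intro s hs t ht hst hδ
      have h0 : 0 ≤ t - s := by linarith
      set u : ℝ := (s + t) / 2 with hu
      have hsu : u - s = (t - s) / 2 := by rw [hu]; ring
      have hut : t - u = (t - s) / 2 := by rw [hu]; ring
      have hu' : u ∈ Icc 0 T := ⟨by rw [hu]; linarith [hs.1, ht.1], by rw [hu]; linarith [hs.2, ht.2]⟩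
      have h1 := ih s hs u hu' (by linarith) (by linarith)
      have h2 := ih u hu' t ht (by linarith) (by linarith)
      rw [hsu] at h1
      rw [hut] at h2
      have h3 := hR.coboundary s hs u hu' t ht
      have h4 := hf s hs u hu' (by linarith) (by linarith)
      have h5 := hg u hu' t ht (by linarith) (by linarith)
      rw [hsu] at h4
      rw [hut] at h5
      have h6 : ‖matVec (f u - f s) (g t - g u)‖ ≤ F * M * (t - s) ^ (2 * r) := by
        have hle : ((t - s) / 2) ^ r ≤ (t - s) ^ r :=
          Real.rpow_le_rpow (by linarith) (by linarith) (by linarith)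
        calc _ ≤ ‖f u - f s‖ * ‖g t - g u‖ := norm_matVec_le _ _
          _ ≤ (F * ((t - s) / 2) ^ r) * (M * ((t - s) / 2) ^ r) := by gcongr
          _ ≤ (F * (t - s) ^ r) * (M * (t - s) ^ r) := by gcongr
          _ = F * M * (t - s) ^ (2 * r) := by
            rw [two_mul r, Real.rpow_add' h0 (by linarith)]; ring
      have h7 : R s t = R s u + R u t + matVec (f u - f s) (g t - g u) := by
        rw [← h3]; abel
      have h8 := two_mul_half_rpow h0 μ
      have h9 := two_mul_half_rpow h0 (2 * r)
      rw [← hρdef] at h8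
      rw [← hθdef] at h9
      calc ‖R s t‖ ≤ ‖R s u‖ + ‖R u t‖ + ‖matVec (f u - f s) (g t - g u)‖ := by
            rw [h7]; exact norm_add₃_le
        _ ≤ C * ρ ^ n * (2 * ((t - s) / 2) ^ μ) + B * (2 * ((t - s) / 2) ^ (2 * r))
            + F * M * (t - s) ^ (2 * r) := by linarith
        _ = C * ρ ^ (n + 1) * (t - s) ^ μ + (θ * B + F * M) * (t - s) ^ (2 * r) := by
            rw [h8, h9, pow_succ]; ring
        _ = _ := by rw [← hBeq]
  have hρ0 : 0 ≤ ρ := by positivity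
  have hlim : Filter.Tendsto (fun n : ℕ => C * ρ ^ n * (t - s) ^ μ + B * (t - s) ^ (2 * r))
      Filter.atTop (nhds (C * 0 * (t - s) ^ μ + B * (t - s) ^ (2 * r))) :=
    (((tendsto_pow_atTop_nhds_zero_of_lt_one hρ0 (two_rpow_one_sub_lt_one hμ)).const_mul
      C).mul_const _).add_const _
  have := ge_of_tendsto' hlim fun n => key n s hs t ht hst hδ
  simpa using this

/-! ### The reflection map -/

/-- If the maximum up to `t` is attained before `s`, then `y` has not grown. Otherwise it is
attained at some `u ≥ s`, and `(z u)⁻` exceeds `(z s)⁻ ≤ y s` by at most the oscillation of `z`. -/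
theorem abs_reflection_sub_le {T : ℝ} {z y : ℝ → ℝ}
    (hy : ∀ t ∈ Icc 0 T, IsGreatest ((fun s => (z s)⁻) '' Icc 0 t) (y t))
    {s t D : ℝ} (hs : s ∈ Icc 0 T) (ht : t ∈ Icc 0 T) (hst : s ≤ t)
    (hD : ∀ u ∈ Icc s t, |z u - z s| ≤ D) : |y t - y s| ≤ D := by
  have hD0 : 0 ≤ D := (abs_nonneg _).trans (hD s ⟨le_rfl, hst⟩)
  have hmono : y s ≤ y t :=
    (hy t ht).2 (image_mono (Icc_subset_Icc_right hst) (hy s hs).1)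
  obtain ⟨u, hu, huy⟩ := (hy t ht).1
  rw [abs_of_nonneg (by linarith)]
  rcases le_total u s with h | h
  · have : y t ≤ y s := (hy s hs).2 ⟨u, ⟨hu.1, h⟩, huy⟩
    linarith
  · have h1 : (z s)⁻ ≤ y s := (hy s hs).2 ⟨s, ⟨hs.1, le_rfl⟩, rfl⟩
    have h2 := (abs_le.1 (hD u ⟨h, hu.2⟩)).1
    have h3 : (z u)⁻ ≤ (z s)⁻ + D := by
      rw [negPart_def, negPart_def]
      refine sup_le ?_ (add_nonneg le_sup_right hD0)
      have : -z s ≤ -z s ⊔ 0 := le_sup_left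
      linarith
    have h4 : (z u)⁻ = y t := huy
    linarith

theorem EuclideanSpace.norm_le_card_mul {d : ℕ} (v : EuclideanSpace ℝ (Fin d)) {D : ℝ}
    (hv : ∀ i, |v i| ≤ D) : ‖v‖ ≤ d * D := by
  have h : v = ∑ i, EuclideanSpace.single i (v i) := by
    ext j; simp [Finset.sum_apply]
  calc ‖v‖ ≤ ∑ i, ‖EuclideanSpace.single i (v i)‖ := by conv_lhs => rw [h]
                                                        exact norm_sum_le _ _
    _ ≤ ∑ _i : Fin d, D := Finset.sum_le_sum fun i _ => by simpa using hv i
    _ = d * D := by simp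

theorem HolderAtScale.add_reflection {d : ℕ} {r T δ D : ℝ} (hr : 0 ≤ r) (hD : 0 ≤ D)
    {x y z : ℝ → EuclideanSpace ℝ (Fin d)} (hz : HolderAtScale r T δ D z)
    (hy : ∀ t ∈ Icc 0 T, ∀ i, IsGreatest ((fun s => (z s i)⁻) '' Icc 0 t) (y t i))
    (hx : ∀ t ∈ Icc 0 T, x t = z t + y t) : HolderAtScale r T δ ((1 + d) * D) x := by
  intro s hs t ht hst hδ
  have h1 : ‖y t - y s‖ ≤ d * (D * (t - s) ^ r) := by
    refine EuclideanSpace.norm_le_card_mul _ fun i => ?_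
    refine abs_reflection_sub_le (z := fun s => z s i) (y := fun s => y s i) (fun t ht => hy t ht i)
      hs ht hst fun u hu => ?_
    have h2 := hz s hs u ⟨hs.1.trans hu.1, hu.2.trans ht.2⟩ hu.1 (by linarith [hu.2])
    have h3 : |z u i - z s i| ≤ ‖z u - z s‖ := by
      simpa using PiLp.norm_apply_le (z u - z s) i
    have h4 : (u - s) ^ r ≤ (t - s) ^ r :=
      Real.rpow_le_rpow (by linarith [hu.1]) (by linarith [hu.2]) hr
    calc |z u i - z s i| ≤ D * (u - s) ^ r := h3.trans h2
      _ ≤ D * (t - s) ^ r := by gcongr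
  rw [hx t ht, hx s hs]
  calc ‖z t + y t - (z s + y s)‖ = ‖(z t - z s) + (y t - y s)‖ := by congr 1; abel
    _ ≤ D * (t - s) ^ r + d * (D * (t - s) ^ r) :=
      (norm_add_le _ _).trans (add_le_add (hz s hs t ht hst hδ) h1)
    _ = (1 + d) * D * (t - s) ^ r := by ring

/-! ### The a priori estimate for reflected solutions -/

/-- Turns any bound on the sewing remainder into one on `x`. It is used twice: with the qualitative
order of `R`, to get some finite constant, and with the sewing estimate, to improve that constant.
-/
theorem HolderAtScale.of_sewing_bound {d m : ℕ} {T r δ M K Kb ρ : ℝ} (hr : 0 ≤ r) (hr1 : r ≤ 1)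
    (hM : 0 ≤ M) (hK : 0 ≤ K) (hKb : 0 ≤ Kb) (hρ : 0 ≤ ρ)
    {x₀ : EuclideanSpace ℝ (Fin d)} {β x y z : ℝ → EuclideanSpace ℝ (Fin d)}
    {f : ℝ → Matrix (Fin d) (Fin m) ℝ} {g : ℝ → EuclideanSpace ℝ (Fin m)}
    {J R : ℝ → ℝ → EuclideanSpace ℝ (Fin d)}
    (hβ : IntegrableOn β (Icc 0 T)) (hβK : ∀ t ∈ Icc 0 T, ‖β t‖ ≤ Kb)
    (hfK : ∀ t ∈ Icc 0 T, ‖f t‖ ≤ K) (hg : HolderAtScale r T δ M g)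
    (hR : IsSewingOf T f g R)
    (hJ : ∀ s ∈ Icc 0 T, ∀ t ∈ Icc 0 T, J s t = matVec (f s) (g t - g s) + R s t)
    (hz : ∀ t ∈ Icc 0 T, z t = x₀ + (∫ s in (0 : ℝ)..t, β s) + J 0 t)
    (hy : ∀ t ∈ Icc 0 T, ∀ i, IsGreatest ((fun s => (z s i)⁻) '' Icc 0 t) (y t i))
    (hx : ∀ t ∈ Icc 0 T, x t = z t + y t)
    (hRρ : ∀ s ∈ Icc 0 T, ∀ t ∈ Icc 0 T, s ≤ t → t - s ≤ δ → ‖R s t‖ ≤ ρ * (t - s) ^ r) :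
    HolderAtScale r T δ ((1 + d) * (Kb * T ^ (1 - r) + K * M + ρ)) x := by
  rcases lt_or_ge T 0 with hT | hT
  · intro u hu; linarith [hu.1, hu.2]
  refine HolderAtScale.add_reflection hr (by positivity) ?_ hy hx
  intro s hs t ht hst hδ
  have h0 : 0 ≤ t - s := by linarith
  have h0T : (0 : ℝ) ∈ Icc 0 T := ⟨le_rfl, hT⟩
  -- The coboundary relation is exactly the additivity of the Young integral.
  have hJadd : J 0 t - J 0 s = J s t := by
    have hc := hR.coboundary 0 h0T s hs t ht
    rw [hJ 0 h0T t ht, hJ 0 h0T s hs, hJ s hs t ht]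
    have : R 0 t = R 0 s + R s t + matVec (f s - f 0) (g t - g s) := by rw [← hc]; abel
    rw [this]
    simp only [matVec, map_sub, LinearMap.sub_apply]
    abel
  have hint : ∀ a ∈ Icc 0 T, ∀ c ∈ Icc 0 T, IntervalIntegrable β volume a c := by
    intro a ha c hc
    exact (hβ.mono_set (uIcc_subset_Icc ha hc)).intervalIntegrable
  have hβadd : (∫ s in (0 : ℝ)..t, β s) - ∫ s in (0 : ℝ)..s, β s = ∫ r in s..t, β r :=
    intervalIntegral.integral_interval_sub_left (hint 0 h0T t ht) (hint 0 h0T s hs)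
  have hzs : z t - z s = (∫ r in s..t, β r) + (matVec (f s) (g t - g s) + R s t) := by
    rw [← hJ s hs t ht, ← hJadd, ← hβadd, hz t ht, hz s hs]; abel
  have hb1 : ‖∫ r in s..t, β r‖ ≤ Kb * |t - s| := by
    refine intervalIntegral.norm_integral_le_of_norm_le_const fun u hu => ?_
    rw [uIoc_of_le hst] at hu
    exact hβK u ⟨hs.1.trans hu.1.le, hu.2.trans ht.2⟩
  have hb2 : t - s ≤ T ^ (1 - r) * (t - s) ^ r := by
    rcases h0.eq_or_lt with h | h
    · rw [← h]; positivity
    · calc t - s = (t - s) ^ (1 - r) * (t - s) ^ r := by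
            rw [← Real.rpow_add h]; simp
        _ ≤ T ^ (1 - r) * (t - s) ^ r := by
            gcongr
            linarith [hs.1, ht.2]
  have hm : ‖matVec (f s) (g t - g s)‖ ≤ K * (M * (t - s) ^ r) :=
    (norm_matVec_le _ _).trans
      (mul_le_mul (hfK s hs) (hg s hs t ht hst hδ) (norm_nonneg _) hK)
  rw [abs_of_nonneg h0] at hb1
  calc ‖z t - z s‖ ≤ ‖∫ r in s..t, β r‖ + (‖matVec (f s) (g t - g s)‖ + ‖R s t‖) := by
        rw [hzs]; exact (norm_add_le _ _).trans (add_le_add le_rfl (norm_add_le _ _))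
    _ ≤ Kb * (T ^ (1 - r) * (t - s) ^ r) + (K * (M * (t - s) ^ r) + ρ * (t - s) ^ r) := by
        gcongr
        · exact hb1.trans (by gcongr)
        · exact hRρ s hs t ht hst hδ
    _ = _ := by ring

/-- Pathwise a priori estimate: the Hölder norm of a reflected solution is bounded by a polynomial
in the Hölder norm of the driving path, with constants depending only on the coefficients. -/
theorem exists_holder_bound_of_isReflectedSolution {d m : ℕ} {T ν r : ℝ} (hT : 0 < T)
    (hr : 1 / 2 < r) (hr1 : r ≤ 1) (hrν : r ≤ ν)
    {b : ℝ → EuclideanSpace ℝ (Fin d) → EuclideanSpace ℝ (Fin d)}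
    {σ : ℝ → EuclideanSpace ℝ (Fin d) → Matrix (Fin d) (Fin m) ℝ}
    (hσ : HypSigma T ν σ) (hb : HypDrift T b) :
    ∃ C : ℝ, 0 ≤ C ∧ ∀ (x₀ : EuclideanSpace ℝ (Fin d)) (g : ℝ → EuclideanSpace ℝ (Fin m))
      (x : ℝ → EuclideanSpace ℝ (Fin d)) (M : ℝ), 0 ≤ M → HolderAtScale r T T M g →
      IsReflectedSolution T x₀ b σ g x → HolderAtScale r T T (C * (1 + M) ^ 3) x := by
  obtain ⟨⟨K', hK'⟩, K₀', hLip', hTime'⟩ := hσ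
  obtain ⟨⟨Kb', hKb'⟩, -⟩ := hb
  obtain ⟨K, hK0, hK⟩ : ∃ K : ℝ, 0 ≤ K ∧ ∀ t ∈ Icc 0 T, ∀ x, ‖σ t x‖ ≤ K :=
    ⟨|K'|, abs_nonneg _, fun t ht x => (hK' t ht x).trans (le_abs_self _)⟩
  obtain ⟨Kb, hKb0, hKb⟩ : ∃ K : ℝ, 0 ≤ K ∧ ∀ t ∈ Icc 0 T, ∀ x, ‖b t x‖ ≤ K :=
    ⟨|Kb'|, abs_nonneg _, fun t ht x => (hKb' t ht x).trans (le_abs_self _)⟩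
  obtain ⟨K₀, hK₀0, hLip, hTime⟩ : ∃ K₀ : ℝ, 0 ≤ K₀ ∧
      (∀ t ∈ Icc 0 T, ∀ x y, ‖σ t x - σ t y‖ ≤ K₀ * ‖x - y‖) ∧
      ∀ x, ∀ t ∈ Icc 0 T, ∀ s ∈ Icc 0 T, ‖σ t x - σ s x‖ ≤ K₀ * |t - s| ^ ν := by
    refine ⟨|K₀'|, abs_nonneg _, fun t ht x y => (hLip' t ht x y).trans ?_,
      fun x t ht s hs => (hTime' x t ht s hs).trans ?_⟩
    · exact mul_le_mul_of_nonneg_right (le_abs_self _) (norm_nonneg _)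
    · exact mul_le_mul_of_nonneg_right (le_abs_self _) (by positivity)
  have hθ : (2 : ℝ) ^ (1 - 2 * r) < 1 := two_rpow_one_sub_lt_one (by linarith)
  have hθ0 : (0 : ℝ) < 2 ^ (1 - 2 * r) := by positivity
  set A₀ : ℝ := (1 - 2 ^ (1 - 2 * r))⁻¹ with hA₀
  have hA₀1 : 1 ≤ A₀ := (one_le_inv₀ (by linarith)).2 (by linarith)
  set K₁ : ℝ := K₀ * T ^ (ν - r) with hK₁
  have hK₁0 : 0 ≤ K₁ := by positivity
  -- Large enough that `δ ^ r = 1 / (κ * (1 + M))` bounds the remainder's contribution by `K₁ + L /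
  -- 2`. The `+ 1` also gives `κ ≥ 1`, needed to compare powers of `κ * (1 + M)`.
  set κ : ℝ := 2 * (1 + d) * A₀ * (K₀ + 1) with hκ
  have hd0 : (0 : ℝ) ≤ d := by positivity
  have hκ1 : 1 ≤ κ := by
    have h1 : (1 : ℝ) ≤ 2 * (1 + d) := by linarith
    exact one_le_mul_of_one_le_of_one_le (one_le_mul_of_one_le_of_one_le h1 hA₀1) (by linarith)
  set D : ℝ := (1 + d) * (Kb * T ^ (1 - r) + K) + K₁ with hD
  have hD0 : 0 ≤ D := by positivity
  refine ⟨(T * κ ^ 2 + 2) * (2 * D), by positivity, ?_⟩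
  rintro x₀ g x M hM hg ⟨hint, J, z, y, hYoung, hz, hy, hx⟩
  obtain ⟨R, hR, hJ⟩ := hYoung.eq
  set δ : ℝ := (κ * (1 + M)) ^ (-(1 / r)) with hδ
  have hκM : 1 ≤ κ * (1 + M) := one_le_mul_of_one_le_of_one_le hκ1 (by linarith)
  have hκM0 : 0 < κ * (1 + M) := by linarith
  have hδ0 : 0 < δ := by positivity
  have hδr : δ ^ r = (κ * (1 + M))⁻¹ := by
    rw [hδ, ← Real.rpow_mul hκM0.le, ← Real.rpow_neg_one]
    congr 1
    have : r ≠ 0 := by linarith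
    field_simp
  -- Here `1 / r ≤ 2`; this is the quadratic factor of the final cube.
  have hδinv : δ⁻¹ ≤ (κ * (1 + M)) ^ 2 := by
    rw [hδ, Real.rpow_neg hκM0.le, inv_inv, ← Real.rpow_natCast]
    refine Real.rpow_le_rpow_of_exponent_le hκM ?_
    rw [div_le_iff₀ (by linarith)]; push_cast; linarith
  have hgδ : HolderAtScale r T δ M g := hg.of_le
  have hsewn : ∀ ρ, 0 ≤ ρ →
      (∀ s ∈ Icc 0 T, ∀ t ∈ Icc 0 T, s ≤ t → t - s ≤ δ → ‖R s t‖ ≤ ρ * (t - s) ^ r) →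
      HolderAtScale r T δ ((1 + d) * (Kb * T ^ (1 - r) + K * M + ρ)) x := fun ρ hρ h =>
    HolderAtScale.of_sewing_bound (by linarith) hr1 hM hK0 hKb0 hρ hint
      (fun t ht => hKb t ht _) (fun t ht => hK t ht _) hgδ hR hJ hz hy hx h
  -- The contraction needs a finite starting constant. Its size, which depends on the unknown `μ`
  -- and `C`, is irrelevant.
  have hfin : ∃ L, 0 ≤ L ∧ HolderAtScale r T δ L x := by
    obtain ⟨μ, hμ, C, hC⟩ := hR.order
    refine ⟨_, ?_, hsewn (|C| * T ^ (μ - r)) (by positivity) ?_⟩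
    · positivity
    · intro s hs t ht hst _
      have h0 : 0 ≤ t - s := by linarith
      have h1 := hC s hs t ht
      rw [abs_of_nonneg h0] at h1
      refine h1.trans ?_
      have h2 : (t - s) ^ μ = (t - s) ^ (μ - r) * (t - s) ^ r := by
        rw [← Real.rpow_add' h0 (by linarith)]; simp
      rw [h2, mul_assoc]
      gcongr
      · exact le_abs_self _
      · linarith
      · linarith [hs.1, ht.2]
  obtain ⟨L, hL0, hL⟩ := hfin
  have hloc : HolderAtScale r T δ (2 * (D * (1 + M))) x := by
    refine HolderAtScale.of_contraction (by positivity) hL0 hL fun L hL0 hL => ?_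
    have hf : HolderAtScale r T δ (K₁ + K₀ * L) (fun s => σ s (x s)) := by
      intro s hs t ht hst hδ'
      have h0 : 0 ≤ t - s := by linarith
      have h1 : ‖σ t (x t) - σ t (x s)‖ ≤ K₀ * (L * (t - s) ^ r) :=
        (hLip t ht _ _).trans (mul_le_mul_of_nonneg_left (hL s hs t ht hst hδ') hK₀0)
      have h2 : ‖σ t (x s) - σ s (x s)‖ ≤ K₁ * (t - s) ^ r := by
        refine (hTime _ t ht s hs).trans ?_
        have h3 : (t - s) ^ ν = (t - s) ^ (ν - r) * (t - s) ^ r := by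
          rw [← Real.rpow_add' h0 (by linarith)]; simp
        rw [abs_of_nonneg h0, h3, hK₁, mul_assoc]
        gcongr
        linarith [hs.1, ht.2]
      calc ‖σ t (x t) - σ s (x s)‖
          = ‖(σ t (x t) - σ t (x s)) + (σ t (x s) - σ s (x s))‖ := by congr 1; abel
        _ ≤ K₀ * (L * (t - s) ^ r) + K₁ * (t - s) ^ r :=
          (norm_add_le _ _).trans (add_le_add h1 h2)
        _ = (K₁ + K₀ * L) * (t - s) ^ r := by ring
    have hρ := hsewn (A₀ * ((K₁ + K₀ * L) * M) * δ ^ r) (by positivity) (by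
      intro s hs t ht hst hδ'
      have h0 : 0 ≤ t - s := by linarith
      refine (hR.norm_le hr (by positivity) hM hf hgδ hs ht hst hδ').trans ?_
      have h2 : (t - s) ^ (2 * r) ≤ δ ^ r * (t - s) ^ r := by
        rw [two_mul, Real.rpow_add' h0 (by linarith)]
        gcongr
      rw [mul_assoc _ (δ ^ r)]
      gcongr)
    refine hρ.mono_const ?_
    have hq : (1 + d) * (A₀ * ((K₁ + K₀ * L) * M) * δ ^ r) ≤ K₁ + L / 2 := by
      rw [hδr, ← div_eq_mul_inv, ← mul_div_assoc, div_le_iff₀ hκM0]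
      have hp : 0 ≤ (1 + d) * A₀ := by positivity
      have e1 : (1 + (d : ℝ)) * (A₀ * ((K₁ + K₀ * L) * M))
          = ((1 + d) * A₀) * ((K₁ + K₀ * L) * M) := by ring
      have e2 : (K₁ + L / 2) * (κ * (1 + M))
          = ((1 + d) * A₀) * ((2 * K₁ + L) * ((K₀ + 1) * (1 + M))) := by rw [hκ]; ring
      rw [e1, e2]
      refine mul_le_mul_of_nonneg_left ?_ hp
      have e3 : K₁ + K₀ * L ≤ (2 * K₁ + L) * (K₀ + 1) := by
        linarith [mul_nonneg hK₁0 hK₀0, show (2 * K₁ + L) * (K₀ + 1)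
          = 2 * (K₁ * K₀) + 2 * K₁ + K₀ * L + L by ring]
      rw [← mul_assoc]
      exact mul_le_mul e3 (by linarith) hM (by positivity)
    have hs : 0 ≤ (1 + d) * (Kb * T ^ (1 - r)) * M + (1 + d) * K + K₁ * M := by positivity
    calc _ = (1 + d) * (Kb * T ^ (1 - r) + K * M)
          + (1 + d) * (A₀ * ((K₁ + K₀ * L) * M) * δ ^ r) := by ring
      _ ≤ (1 + d) * (Kb * T ^ (1 - r) + K * M) + (K₁ + L / 2) := by gcongr
      _ ≤ D * (1 + M) + L / 2 := by
        rw [hD]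
        linarith [hs, show ((1 + d) * (Kb * T ^ (1 - r) + K) + K₁) * (1 + M)
          = (1 + d) * (Kb * T ^ (1 - r) + K * M) + K₁
            + ((1 + d) * (Kb * T ^ (1 - r)) * M + (1 + d) * K + K₁ * M) by ring]
  have hN : T ≤ ((⌈T / δ⌉₊ + 1 : ℕ) : ℝ) * δ := by
    rw [← div_le_iff₀ hδ0]; push_cast
    linarith [Nat.le_ceil (T / δ)]
  refine (hloc.chain (by linarith) (by positivity) (by omega) hN).mono_const ?_
  have hNle : ((⌈T / δ⌉₊ + 1 : ℕ) : ℝ) ≤ (T * κ ^ 2 + 2) * (1 + M) ^ 2 := by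
    push_cast
    have h1 : (⌈T / δ⌉₊ : ℝ) < T / δ + 1 := Nat.ceil_lt_add_one (by positivity)
    have h2 : T / δ ≤ T * (κ * (1 + M)) ^ 2 := by
      rw [div_eq_mul_inv]; gcongr
    have h3 : 1 ≤ (1 + M) ^ 2 := one_le_pow₀ (by linarith)
    calc (⌈T / δ⌉₊ : ℝ) + 1 ≤ T * (κ * (1 + M)) ^ 2 + 2 * 1 := by linarith
      _ ≤ T * (κ * (1 + M)) ^ 2 + 2 * (1 + M) ^ 2 := by gcongr
      _ = _ := by ring
  calc _ ≤ (T * κ ^ 2 + 2) * (1 + M) ^ 2 * (2 * (D * (1 + M))) := by gcongr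
    _ = _ := by ring

/-! ### Hölder norms and continuity -/

theorem HolderAtScale.continuousOn {E : Type*} [NormedAddCommGroup E] {r T C : ℝ} {f : ℝ → E}
    (hr : 0 < r) (hf : HolderAtScale r T T C f) : ContinuousOn f (Icc 0 T) := by
  have hb : ∀ u ∈ Icc 0 T, ∀ v ∈ Icc 0 T, ‖f v - f u‖ ≤ C * |v - u| ^ r := by
    intro u hu v hv
    rcases le_total u v with h | h
    · rw [abs_of_nonneg (by linarith)]
      exact hf u hu v hv h (by linarith [hu.1, hv.2])
    · rw [abs_sub_comm, norm_sub_rev, abs_of_nonneg (by linarith)]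
      exact hf v hv u hu h (by linarith [hv.1, hu.2])
  intro u hu
  rw [ContinuousWithinAt, tendsto_iff_norm_sub_tendsto_zero]
  have hlim : Filter.Tendsto (fun v : ℝ => C * |v - u| ^ r) (nhdsWithin u (Icc 0 T)) (nhds 0) := by
    have hc : ContinuousAt (fun v : ℝ => C * |v - u| ^ r) u := by
      refine ContinuousAt.const_mul ?_ _
      exact ContinuousAt.rpow_const (by fun_prop) (Or.inr hr.le)
    have := hc.tendsto.mono_left (nhdsWithin_le_nhds (s := Icc 0 T))
    simpa [Real.zero_rpow hr.ne'] using this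
  refine squeeze_zero' (Filter.Eventually.of_forall fun _ => norm_nonneg _) ?_ hlim
  filter_upwards [self_mem_nhdsWithin] with v hv using hb u hu v hv

theorem HolderAtScale.holderNormOn_le {E : Type*} [NormedAddCommGroup E] {r T C : ℝ} {f : ℝ → E}
    (hf : HolderAtScale r T T C f) : holderNormOn r 0 T f ≤ ENNReal.ofReal C := by
  refine iSup_le fun u => iSup_le fun v => iSup_le fun h => ENNReal.ofReal_le_ofReal ?_
  have h0 : 0 < v - u := by linarith [h.2.1]
  rw [div_le_iff₀ (by positivity)]
  exact hf u ⟨h.1, by linarith [h.2.1, h.2.2]⟩ v ⟨by linarith [h.1, h.2.1], h.2.2⟩ h.2.1.le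
    (by linarith [h.1, h.2.2])

theorem holderAtScale_of_holderNormOn_lt_top {E : Type*} [NormedAddCommGroup E] {r T : ℝ}
    {f : ℝ → E} (hr : 0 < r) (hf : holderNormOn r 0 T f < ∞) :
    HolderAtScale r T T (holderNormOn r 0 T f).toReal f := by
  intro u hu v hv huv _
  rcases huv.eq_or_lt with rfl | h
  · simp [Real.zero_rpow hr.ne']
  have h0 : 0 < v - u := by linarith
  have h1 : ENNReal.ofReal (‖f v - f u‖ / (v - u) ^ r) ≤ holderNormOn r 0 T f :=
    le_iSup_of_le u (le_iSup_of_le v (le_iSup_of_le ⟨hu.1, h, hv.2⟩ le_rfl))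
  rw [← div_le_iff₀ (by positivity)]
  exact (ENNReal.ofReal_le_iff_le_toReal hf.ne).1 h1

/-- Since `T` may be irrational, the approximants are taken in the open interval, which is dense in
`[0,T]`. -/
theorem exists_seq_rat_mem_Icc_tendsto {T : ℝ} (hT : 0 < T) {u : ℝ} (hu : u ∈ Icc 0 T) :
    ∃ p : ℕ → ℚ, (∀ n, (p n : ℝ) ∈ Icc 0 T) ∧
      Filter.Tendsto (fun n => (p n : ℝ)) Filter.atTop (nhds u) := by
  have h1 : u ∈ closure (Ioo 0 T ∩ range ((↑) : ℚ → ℝ)) := by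
    rw [← closure_Ioo hT.ne] at hu
    exact closure_minimal (Rat.denseRange_cast.open_subset_closure_inter isOpen_Ioo)
      isClosed_closure hu
  obtain ⟨x, hx, hlim⟩ := mem_closure_iff_seq_limit.1 h1
  choose p hp using fun n => (hx n).2
  refine ⟨p, fun n => ?_, ?_⟩
  · rw [hp n]; exact Ioo_subset_Icc_self (hx n).1
  · simpa only [hp] using hlim

/-- The Hölder quotient is continuous in `(u, v)` for `u < v`. A countable supremum is what makes
the norm measurable. -/
theorem holderNormOn_eq_iSup_rat {E : Type*} [NormedAddCommGroup E] {r T : ℝ} (hT : 0 < T)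
    {f : ℝ → E} (hf : ContinuousOn f (Icc 0 T)) :
    holderNormOn r 0 T f = ⨆ (p : ℚ) (q : ℚ) (_ : (0 : ℝ) ≤ p ∧ (p : ℝ) < q ∧ (q : ℝ) ≤ T),
      ENNReal.ofReal (‖f q - f p‖ / ((q : ℝ) - p) ^ r) := by
  refine le_antisymm ?_ ?_
  · refine iSup_le fun u => iSup_le fun v => iSup_le fun h => ?_
    have hu : u ∈ Icc 0 T := ⟨h.1, by linarith [h.2.1, h.2.2]⟩
    have hv : v ∈ Icc 0 T := ⟨by linarith [h.1, h.2.1], h.2.2⟩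
    obtain ⟨p, hpT, hp⟩ := exists_seq_rat_mem_Icc_tendsto hT hu
    obtain ⟨q, hqT, hq⟩ := exists_seq_rat_mem_Icc_tendsto hT hv
    have hfp : Filter.Tendsto (fun n => f (p n)) Filter.atTop (nhds (f u)) :=
      (hf u hu).tendsto.comp (tendsto_nhdsWithin_iff.2 ⟨hp, Filter.Eventually.of_forall hpT⟩)
    have hfq : Filter.Tendsto (fun n => f (q n)) Filter.atTop (nhds (f v)) :=
      (hf v hv).tendsto.comp (tendsto_nhdsWithin_iff.2 ⟨hq, Filter.Eventually.of_forall hqT⟩)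
    have h0 : 0 < v - u := by linarith [h.2.1]
    have hlim : Filter.Tendsto
        (fun n => ENNReal.ofReal (‖f (q n) - f (p n)‖ / ((q n : ℝ) - p n) ^ r)) Filter.atTop
        (nhds (ENNReal.ofReal (‖f v - f u‖ / (v - u) ^ r))) :=
      ENNReal.tendsto_ofReal ((hfq.sub hfp).norm.div
        ((hq.sub hp).rpow_const (Or.inl h0.ne')) (by positivity))
    refine le_of_tendsto hlim ?_
    filter_upwards [hp.eventually_lt hq h.2.1] with n hn
    exact le_iSup_of_le (p n) (le_iSup_of_le (q n)
      (le_iSup_of_le ⟨(hpT n).1, hn, (hqT n).2⟩ le_rfl))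
  · refine iSup_le fun p => iSup_le fun q => iSup_le fun h => ?_
    exact le_iSup_of_le (p : ℝ) (le_iSup_of_le (q : ℝ) (le_iSup_of_le h le_rfl))

theorem aemeasurable_holderNormOn {Ω : Type*} [MeasurableSpace Ω] {P : Measure Ω}
    {E : Type*} [NormedAddCommGroup E] [MeasurableSpace E] [BorelSpace E]
    [SecondCountableTopology E] {r T : ℝ} (hT : 0 < T) {X : ℝ → Ω → E}
    (hX : ∀ t ∈ Icc 0 T, AEMeasurable (X t) P)
    (hc : ∀ᵐ ω ∂P, ContinuousOn (fun t => X t ω) (Icc 0 T)) :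
    AEMeasurable (fun ω => holderNormOn r 0 T (fun t => X t ω)) P := by
  have h1 : AEMeasurable (fun ω => ⨆ (p : ℚ) (q : ℚ)
      (_ : (0 : ℝ) ≤ p ∧ (p : ℝ) < q ∧ (q : ℝ) ≤ T),
      ENNReal.ofReal (‖X q ω - X p ω‖ / ((q : ℝ) - p) ^ r)) P := by
    refine AEMeasurable.iSup fun p => AEMeasurable.iSup fun q => AEMeasurable.iSup fun h => ?_
    have hp := hX p ⟨h.1, by linarith [h.2.1, h.2.2]⟩
    have hq := hX q ⟨by linarith [h.1, h.2.1], h.2.2⟩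
    exact ((hq.sub hp).norm.div_const _).ennreal_ofReal
  refine h1.congr ?_
  filter_upwards [hc] with ω hω using (holderNormOn_eq_iSup_rat hT hω).symm

/-! ### Dyadic chaining -/

/-- The dyadic approximations of `t` from below at levels `n` and `n + 1` coincide or are neighbours
at level `n + 1`. Their differences therefore sum to a geometric tail. -/
theorem norm_sub_le_of_dyadic {E : Type*} [NormedAddCommGroup E] {q M : ℝ}
    (hq0 : 0 < q) (hq1 : q < 1) (hM : 0 ≤ M) {f : ℝ → E} (hf : ContinuousOn f (Icc 0 1))
    (hdy : ∀ n k : ℕ, k < 2 ^ n → ‖f ((k + 1 : ℕ) / 2 ^ n) - f (k / 2 ^ n)‖ ≤ M * q ^ n)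
    {t : ℝ} (ht : t ∈ Icc (0 : ℝ) 1) (n : ℕ) :
    ‖f (⌊t * 2 ^ n⌋₊ / 2 ^ n) - f t‖ ≤ M * q ^ n / (1 - q) := by
  have hfl : ∀ n : ℕ, (⌊t * 2 ^ n⌋₊ : ℝ) ≤ t * 2 ^ n := fun n =>
    Nat.floor_le (mul_nonneg ht.1 (by positivity))
  have hlt : ∀ n : ℕ, t * 2 ^ n < ⌊t * 2 ^ n⌋₊ + 1 := fun n => Nat.lt_floor_add_one _
  have hmem : ∀ n : ℕ, (⌊t * 2 ^ n⌋₊ / 2 ^ n : ℝ) ∈ Icc (0 : ℝ) 1 := fun n => by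
    refine ⟨by positivity, ?_⟩
    rw [div_le_one (by positivity)]
    have : t * 2 ^ n ≤ 1 * 2 ^ n := by gcongr; exact ht.2
    linarith [hfl n]
  have hlim : Filter.Tendsto (fun n : ℕ => (⌊t * 2 ^ n⌋₊ / 2 ^ n : ℝ)) Filter.atTop (nhds t) :=
    (tendsto_nat_floor_mul_div_atTop ht.1).comp
      (tendsto_pow_atTop_atTop_of_one_lt (by norm_num : (1 : ℝ) < 2))
  have hlimf : Filter.Tendsto (fun n : ℕ => f (⌊t * 2 ^ n⌋₊ / 2 ^ n : ℝ)) Filter.atTop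
      (nhds (f t)) :=
    (hf t ht).tendsto.comp (tendsto_nhdsWithin_iff.2 ⟨hlim, Filter.Eventually.of_forall hmem⟩)
  rw [← dist_eq_norm]
  refine dist_le_of_le_geometric_of_tendsto q M hq1 (fun n => ?_) hlimf n
  set k := ⌊t * 2 ^ n⌋₊ with hk
  set l := ⌊t * 2 ^ (n + 1)⌋₊ with hl
  have e : t * 2 ^ (n + 1) = 2 * (t * 2 ^ n) := by rw [pow_succ]; ring
  have h1 : 2 * k ≤ l := by
    rw [hl]; apply Nat.le_floor; push_cast; rw [e]; linarith [hfl n]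
  have h2 : l < 2 * k + 2 := by
    have : (l : ℝ) < 2 * k + 2 := by
      linarith [hfl (n + 1), hlt n, e]
    exact_mod_cast this
  have hqn : M * q ^ (n + 1) ≤ M * q ^ n := by
    refine mul_le_mul_of_nonneg_left ?_ hM
    exact pow_le_pow_of_le_one hq0.le hq1.le (by omega)
  have hk2 : ((2 * k : ℕ) : ℝ) / 2 ^ (n + 1) = k / 2 ^ n := by
    push_cast; rw [pow_succ]; field_simp
  rcases (by omega : l = 2 * k ∨ l = 2 * k + 1) with h | h
  · rw [h, hk2, dist_self]; positivity
  · have hl1 : l ≤ 2 ^ (n + 1) := by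
      have : (l : ℝ) ≤ 2 ^ (n + 1) := by
        have := (hmem (n + 1)).2
        rwa [div_le_one (by positivity)] at this
      exact_mod_cast this
    have := hdy (n + 1) (2 * k) (by omega)
    rw [hk2] at this
    rw [dist_comm, dist_eq_norm, h]
    exact this.trans hqn

/-- A continuous function on `[0,1]` is Hölder as soon as its increments between neighbouring dyadic
points are. -/
theorem holderAtScale_one_of_dyadic {E : Type*} [NormedAddCommGroup E] {r M : ℝ}
    (hr : 0 < r) (hM : 0 ≤ M) {f : ℝ → E} (hf : ContinuousOn f (Icc 0 1))
    (hdy : ∀ n k : ℕ, k < 2 ^ n →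
      ‖f ((k + 1 : ℕ) / 2 ^ n) - f (k / 2 ^ n)‖ ≤ M * ((1 / 2 : ℝ) ^ r) ^ n) :
    HolderAtScale r 1 1
      ((1 + 2 / (1 - (1 / 2 : ℝ) ^ r)) / (1 / 2 : ℝ) ^ r * M) f := by
  set q : ℝ := (1 / 2 : ℝ) ^ r with hq
  have hq0 : 0 < q := by positivity
  have hq1 : q < 1 := Real.rpow_lt_one (by norm_num) (by norm_num) hr
  have hq1' : 0 < 1 - q := by linarith
  intro s hs t ht hst _
  rcases hst.eq_or_lt with rfl | hlt
  · simp [Real.zero_rpow hr.ne']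
  -- The level with `(1/2) ^ (n + 1) < t - s ≤ (1/2) ^ n`: the dyadic floors of `s` and `t` differ
  -- by at most one step, and the lower bound costs the factor `1 / q`.
  obtain ⟨n, hn1, hn2⟩ := exists_nat_pow_near_of_lt_one (x := t - s) (y := 1 / 2) (by linarith)
    (by linarith [hs.1, ht.2]) (by norm_num) (by norm_num)
  have hpow : (0 : ℝ) < 2 ^ n := by positivity
  have hn2' : t * 2 ^ n ≤ s * 2 ^ n + 1 := by
    rw [one_div, inv_pow] at hn2
    have h3 : (t - s) * 2 ^ n ≤ (2 ^ n)⁻¹ * 2 ^ n := by gcongr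
    rw [inv_mul_cancel₀ hpow.ne'] at h3
    linarith
  have ha := norm_sub_le_of_dyadic hq0 hq1 hM hf hdy hs n
  have hb := norm_sub_le_of_dyadic hq0 hq1 hM hf hdy ht n
  set k := ⌊s * 2 ^ n⌋₊ with hk
  set l := ⌊t * 2 ^ n⌋₊ with hl
  have hkl : k ≤ l := Nat.floor_le_floor (by gcongr)
  have hlk : l < k + 2 := by
    have h1 : (l : ℝ) ≤ t * 2 ^ n := Nat.floor_le (mul_nonneg ht.1 hpow.le)
    have h2 : s * 2 ^ n < k + 1 := Nat.lt_floor_add_one _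
    have : (l : ℝ) < k + 2 := by linarith
    exact_mod_cast this
  have hmid : ‖f (l / 2 ^ n) - f (k / 2 ^ n)‖ ≤ M * q ^ n := by
    rcases (by omega : l = k ∨ l = k + 1) with h | h
    · rw [h, sub_self, norm_zero]; positivity
    · have hl1 : l ≤ 2 ^ n := by
        have h1 : (l : ℝ) ≤ t * 2 ^ n := Nat.floor_le (mul_nonneg ht.1 hpow.le)
        have h2 : t * 2 ^ n ≤ 1 * 2 ^ n := by gcongr; exact ht.2
        have : (l : ℝ) ≤ 2 ^ n := by linarith
        exact_mod_cast this
      rw [h]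
      exact hdy n k (by omega)
  have hqn : q ^ n ≤ (t - s) ^ r / q := by
    rw [le_div_iff₀ hq0, ← pow_succ, hq, Real.rpow_pow_comm (by norm_num)]
    exact Real.rpow_le_rpow (by positivity) hn1.le hr.le
  rw [norm_sub_rev] at hb
  calc ‖f t - f s‖ = ‖(f t - f (l / 2 ^ n)) + (f (l / 2 ^ n) - f (k / 2 ^ n))
        + (f (k / 2 ^ n) - f s)‖ := by congr 1; abel
    _ ≤ M * q ^ n / (1 - q) + M * q ^ n + M * q ^ n / (1 - q) :=
        norm_add₃_le.trans (add_le_add (add_le_add hb hmid) ha)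
    _ = (1 + 2 / (1 - q)) * M * q ^ n := by ring
    _ ≤ (1 + 2 / (1 - q)) * M * ((t - s) ^ r / q) := by gcongr
    _ = _ := by ring

theorem holderAtScale_of_dyadic {E : Type*} [NormedAddCommGroup E] {r T M : ℝ} (hT : 0 < T)
    (hr : 0 < r) (hM : 0 ≤ M) {f : ℝ → E} (hf : ContinuousOn f (Icc 0 T))
    (hdy : ∀ n k : ℕ, k < 2 ^ n →
      ‖f (T * ((k + 1 : ℕ) / 2 ^ n)) - f (T * (k / 2 ^ n))‖ ≤ M * ((1 / 2 : ℝ) ^ r) ^ n) :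
    HolderAtScale r T T
      ((1 + 2 / (1 - (1 / 2 : ℝ) ^ r)) / (1 / 2 : ℝ) ^ r / T ^ r * M) f := by
  have hmaps : MapsTo (fun u : ℝ => T * u) (Icc 0 1) (Icc 0 T) := fun u hu =>
    ⟨mul_nonneg hT.le hu.1, by nlinarith [hu.2]⟩
  have h1 := holderAtScale_one_of_dyadic (f := fun u => f (T * u)) hr hM
    (hf.comp (by fun_prop) hmaps) hdy
  intro s hs t ht hst _
  have h2 := h1 (s / T) ⟨div_nonneg hs.1 hT.le, (div_le_one hT).2 hs.2⟩
    (t / T) ⟨div_nonneg ht.1 hT.le, (div_le_one hT).2 ht.2⟩ (by gcongr)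
    (by rw [← sub_div, div_le_one hT]; linarith [hs.1, ht.2])
  beta_reduce at h2
  rw [mul_div_cancel₀ _ hT.ne', mul_div_cancel₀ _ hT.ne', ← sub_div,
    Real.div_rpow (by linarith) hT.le] at h2
  refine h2.trans (le_of_eq ?_)
  ring

/-! ### Moments of the Hölder norm of fractional Brownian motion -/

/-- The absolute moment of order `p` of the standard normal distribution. -/
noncomputable def gaussianAbsMoment (p : ℝ) : ℝ≥0∞ := ∫⁻ x, ‖x‖ₑ ^ p ∂(gaussianReal 0 1)

theorem gaussianAbsMoment_lt_top {p : ℝ} (hp : 0 < p) : gaussianAbsMoment p < ∞ := by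
  have h := (memLp_id_gaussianReal (μ := 0) (v := 1) p.toNNReal).eLpNorm_lt_top
  have h2 := lintegral_rpow_enorm_lt_top_of_eLpNorm_lt_top (by simpa using hp)
    ENNReal.coe_ne_top h
  simpa [gaussianAbsMoment, hp.le] using h2

/-- The increment is centred Gaussian with variance `|t - s| ^ (2 * H)`, hence distributed as `|t -
s| ^ H` times a standard normal variable. -/
theorem IsFractionalBrownianMotion.lintegral_increment {Ω : Type*} [MeasurableSpace Ω]
    {P : Measure Ω} {H : ℝ} (hH : 0 < H) {B : ℝ≥0 → Ω → ℝ}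
    (hB : IsFractionalBrownianMotion P H B) (s t : ℝ≥0) {p : ℝ} (hp : 0 ≤ p) :
    ∫⁻ ω, ‖B t ω - B s ω‖ₑ ^ p ∂P
      = ENNReal.ofReal (|(t : ℝ) - s| ^ (H * p)) * gaussianAbsMoment p := by
  have := hB.gaussian.isProbabilityMeasure
  have hlaw : HasGaussianLaw (fun ω => B t ω - B s ω) P := hB.gaussian.hasGaussianLaw_fun_sub
  have hLs := (hB.gaussian.hasGaussianLaw_eval s).memLp_two
  have hLt := (hB.gaussian.hasGaussianLaw_eval t).memLp_two
  have hmean : ∫ ω, B t ω - B s ω ∂P = 0 := by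
    rw [integral_sub (hB.gaussian.hasGaussianLaw_eval t).integrable
      (hB.gaussian.hasGaussianLaw_eval s).integrable, hB.centered, hB.centered, sub_zero]
  have hvar : Var[fun ω => B t ω - B s ω; P] = |(t : ℝ) - s| ^ (2 * H) := by
    have h0 : (0 : ℝ) ^ (2 * H) = 0 := Real.zero_rpow (by linarith)
    rw [variance_fun_sub hLt hLs, ← covariance_self hLt.aestronglyMeasurable.aemeasurable,
      ← covariance_self hLs.aestronglyMeasurable.aemeasurable,
      hB.covariance_eq, hB.covariance_eq, hB.covariance_eq, abs_sub_comm (s : ℝ) t]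
    simp only [sub_self, abs_zero, h0]
    ring
  have hmap := hlaw.map_eq_gaussianReal
  rw [hmean, hvar] at hmap
  set c : ℝ := |(t : ℝ) - s| ^ H with hc
  have hc0 : 0 ≤ c := by positivity
  have hscale : P.map (fun ω => B t ω - B s ω) = (gaussianReal 0 1).map (c * ·) := by
    rw [hmap, gaussianReal_map_const_mul, mul_zero, mul_one]
    congr 1
    ext
    rw [Real.coe_toNNReal _ (by positivity), NNReal.coe_mk, hc, ← Real.rpow_mul_natCast (abs_nonneg _)]
    congr 1
    push_cast; ring
  have hmeas : Measurable fun x : ℝ => ‖x‖ₑ ^ p := by fun_prop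
  calc ∫⁻ ω, ‖B t ω - B s ω‖ₑ ^ p ∂P
      = ∫⁻ x, ‖x‖ₑ ^ p ∂(P.map fun ω => B t ω - B s ω) :=
        (lintegral_map' hmeas.aemeasurable hlaw.aemeasurable).symm
    _ = ∫⁻ x, ‖c * x‖ₑ ^ p ∂(gaussianReal 0 1) := by
        rw [hscale, lintegral_map hmeas (by fun_prop)]
    _ = ∫⁻ x, ‖c‖ₑ ^ p * ‖x‖ₑ ^ p ∂(gaussianReal 0 1) := by
        simp_rw [enorm_mul, ENNReal.mul_rpow_of_nonneg _ _ hp]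
    _ = ‖c‖ₑ ^ p * gaussianAbsMoment p := by
        rw [lintegral_const_mul _ hmeas, gaussianAbsMoment]
    _ = _ := by
        rw [Real.enorm_of_nonneg hc0, ENNReal.ofReal_rpow_of_nonneg hc0 hp, hc,
          ← Real.rpow_mul (abs_nonneg _)]

/-- The weighted sum of `p`-th powers of the increments of `f` along all dyadic subdivisions of
`[0,T]`; it controls the `r`-Hölder norm. -/
noncomputable def dyadicEnergy (r p T : ℝ) (f : ℝ → ℝ) : ℝ≥0∞ :=
  ∑' n : ℕ, ∑ k ∈ Finset.range (2 ^ n), ENNReal.ofReal ((2 ^ (r * p)) ^ n) *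
    ‖f (T * ((k + 1 : ℕ) / 2 ^ n)) - f (T * (k / 2 ^ n))‖ₑ ^ p

/-- Every single increment is dominated by the whole sum; taking `p`-th roots gives the dyadic
hypothesis with `M = V ^ (1 / p)`. -/
theorem holderAtScale_of_dyadicEnergy_le {r p T V : ℝ} (hT : 0 < T) (hr : 0 < r) (hp : 0 < p)
    (hV : 0 ≤ V) {f : ℝ → ℝ} (hf : ContinuousOn f (Icc 0 T))
    (hE : dyadicEnergy r p T f ≤ ENNReal.ofReal V) :
    HolderAtScale r T T
      ((1 + 2 / (1 - (1 / 2 : ℝ) ^ r)) / (1 / 2 : ℝ) ^ r / T ^ r * V ^ (1 / p)) f := by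
  refine holderAtScale_of_dyadic hT hr (by positivity) hf fun n k hk => ?_
  set Δ := f (T * ((k + 1 : ℕ) / 2 ^ n)) - f (T * (k / 2 ^ n)) with hΔ
  have h1 : ENNReal.ofReal ((2 ^ (r * p)) ^ n) * ‖Δ‖ₑ ^ p ≤ ENNReal.ofReal V := by
    refine le_trans ?_ ((ENNReal.le_tsum n).trans hE)
    exact Finset.single_le_sum (f := fun k : ℕ => ENNReal.ofReal ((2 ^ (r * p)) ^ n) *
      ‖f (T * ((k + 1 : ℕ) / 2 ^ n)) - f (T * (k / 2 ^ n))‖ₑ ^ p)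
      (fun _ _ => zero_le) (Finset.mem_range.2 hk)
  rw [← ofReal_norm, ENNReal.ofReal_rpow_of_nonneg (norm_nonneg _) hp.le,
    ← ENNReal.ofReal_mul (by positivity), ENNReal.ofReal_le_ofReal_iff hV] at h1
  rw [← Real.rpow_le_rpow_iff (norm_nonneg _) (by positivity) hp,
    Real.mul_rpow (by positivity) (by positivity), ← Real.rpow_mul hV,
    one_div_mul_cancel hp.ne', Real.rpow_one, ← Real.rpow_pow_comm (by positivity),
    ← Real.rpow_mul (by positivity), one_div, Real.inv_rpow (by norm_num), inv_pow,
    ← div_eq_mul_inv, le_div_iff₀ (by positivity), mul_comm]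
  exact h1

theorem IsFractionalBrownianMotion.lintegral_dyadicEnergy_lt_top {Ω : Type*} [MeasurableSpace Ω]
    {P : Measure Ω} {H r p T : ℝ} (hH : 0 < H) (hT : 0 < T) (hp : 0 < p) (hrp : 1 < (H - r) * p)
    {B : ℝ≥0 → Ω → ℝ} (hB : IsFractionalBrownianMotion P H B) :
    ∫⁻ ω, dyadicEnergy r p T (fun t => B t.toNNReal ω) ∂P < ∞ := by
  have hmeas : ∀ a b : ℝ, AEMeasurable
      (fun ω => ‖B a.toNNReal ω - B b.toNNReal ω‖ₑ ^ p) P := fun a b =>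
    (((hB.gaussian.aemeasurable _).sub (hB.gaussian.aemeasurable _)).enorm).pow_const p
  set c : ℝ≥0∞ := ENNReal.ofReal (T ^ (H * p)) * gaussianAbsMoment p with hc
  have hc_top : c ≠ ∞ := ENNReal.mul_ne_top ENNReal.ofReal_ne_top (gaussianAbsMoment_lt_top hp).ne
  -- Level `n` has `2 ^ n` increments, weight `2 ^ (n * r * p)` and moments proportional to `2 ^ (-n
  -- * H * p)`. The ratio `θ = 2 ^ (1 - (H - r) * p)` is below one exactly when `1 < (H - r) * p`.
  set θ : ℝ := 2 * 2 ^ (r * p) * (1 / 2) ^ (H * p) with hθ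
  have hθ0 : 0 ≤ θ := by positivity
  have hθ1 : θ < 1 := by
    have : θ = 2 ^ (1 - (H - r) * p) := by
      rw [hθ, one_div, Real.inv_rpow (by norm_num), ← Real.rpow_neg (by norm_num)]
      nth_rewrite 1 [← Real.rpow_one 2]
      rw [← Real.rpow_add (by norm_num), ← Real.rpow_add (by norm_num)]
      congr 1; ring
    rw [this]
    exact two_rpow_one_sub_lt_one hrp
  have hincr : ∀ n k : ℕ, ∫⁻ ω, ‖B (T * ((k + 1 : ℕ) / 2 ^ n)).toNNReal ω
      - B (T * (k / 2 ^ n)).toNNReal ω‖ₑ ^ p ∂P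
      = ENNReal.ofReal (((1 / 2) ^ (H * p)) ^ n) * c := by
    intro n k
    rw [hB.lintegral_increment hH _ _ hp.le, Real.coe_toNNReal _ (by positivity),
      Real.coe_toNNReal _ (by positivity)]
    have e : T * ((k + 1 : ℕ) / 2 ^ n) - T * (k / 2 ^ n) = T * (1 / 2) ^ n := by
      push_cast; rw [one_div, inv_pow]; field_simp; ring
    rw [e, abs_of_nonneg (by positivity), Real.mul_rpow hT.le (by positivity),
      ← Real.rpow_pow_comm (by norm_num), ENNReal.ofReal_mul (by positivity), hc]
    ring
  unfold dyadicEnergy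
  rw [lintegral_tsum fun n => Finset.aemeasurable_fun_sum _ fun k _ => (hmeas _ _).const_mul _]
  have hlevel : ∀ n : ℕ, ∫⁻ ω, ∑ k ∈ Finset.range (2 ^ n), ENNReal.ofReal ((2 ^ (r * p)) ^ n) *
      ‖B (T * ((k + 1 : ℕ) / 2 ^ n)).toNNReal ω - B (T * (k / 2 ^ n)).toNNReal ω‖ₑ ^ p ∂P
      = ENNReal.ofReal θ ^ n * c := by
    intro n
    rw [lintegral_finsetSum' _ fun k _ => (hmeas _ _).const_mul _]
    simp_rw [lintegral_const_mul' _ _ ENNReal.ofReal_ne_top, hincr]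
    rw [Finset.sum_const, Finset.card_range, nsmul_eq_mul, ← ENNReal.ofReal_natCast,
      ← mul_assoc, ← mul_assoc, ← ENNReal.ofReal_mul (by positivity),
      ← ENNReal.ofReal_mul (by positivity), ← ENNReal.ofReal_pow hθ0, hθ, mul_pow, mul_pow]
    push_cast
    rfl
  simp_rw [hlevel]
  rw [ENNReal.tsum_mul_right, ENNReal.tsum_geometric]
  refine ENNReal.mul_lt_top ?_ hc_top.lt_top
  rw [ENNReal.inv_lt_top, tsub_pos_iff_lt]
  simpa using hθ1

theorem aemeasurable_dyadicEnergy {Ω : Type*} [MeasurableSpace Ω] {P : Measure Ω} {r p T : ℝ}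
    {B : ℝ≥0 → Ω → ℝ} (hB : ∀ t, AEMeasurable (B t) P) :
    AEMeasurable (fun ω => dyadicEnergy r p T (fun t => B t.toNNReal ω)) P :=
  AEMeasurable.tsum fun _ => Finset.aemeasurable_fun_sum _ fun _ _ =>
    ((((hB _).sub (hB _)).enorm).pow_const p).const_mul _

/-- The Hölder norm of a continuous version of fractional Brownian motion is controlled by a power
of an integrable variable. -/
theorem exists_holder_control_noisePath {Ω : Type*} [MeasurableSpace Ω] {P : Measure Ω} {m : ℕ}
    {T H r p : ℝ} (hT : 0 < T) (hH : 0 < H) (hr : 0 < r) (hp : 0 < p) (hrp : 1 < (H - r) * p)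
    {W : Fin m → ℝ≥0 → Ω → ℝ} (hW : ∀ j, IsFractionalBrownianMotion P H (W j)) :
    ∃ (C : ℝ) (V : Ω → ℝ≥0∞), 0 ≤ C ∧ ∫⁻ ω, V ω ∂P < ∞ ∧ ∀ᵐ ω ∂P, V ω < ∞ ∧
      (ContinuousOn (noisePath W ω) (Icc 0 T) →
        HolderAtScale r T T (C * (V ω).toReal ^ (1 / p)) (noisePath W ω)) := by
  have hq1 : (1 / 2 : ℝ) ^ r < 1 := Real.rpow_lt_one (by norm_num) (by norm_num) hr
  have hq1' : 0 < 1 - (1 / 2 : ℝ) ^ r := by linarith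
  set c : ℝ := (1 + 2 / (1 - (1 / 2 : ℝ) ^ r)) / (1 / 2 : ℝ) ^ r / T ^ r with hc
  have hmeas : ∀ j, AEMeasurable (fun ω => dyadicEnergy r p T (fun t => W j t.toNNReal ω)) P :=
    fun j => aemeasurable_dyadicEnergy fun t => (hW j).gaussian.aemeasurable t
  have hfin : ∫⁻ ω, ∑ j, dyadicEnergy r p T (fun t => W j t.toNNReal ω) ∂P < ∞ := by
    rw [lintegral_finsetSum' _ fun j _ => hmeas j]
    exact ENNReal.sum_lt_top.2 fun j _ => (hW j).lintegral_dyadicEnergy_lt_top hH hT hp hrp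
  refine ⟨m * c, fun ω => ∑ j, dyadicEnergy r p T (fun t => W j t.toNNReal ω), by positivity,
    hfin, ?_⟩
  filter_upwards [ae_lt_top' (Finset.aemeasurable_fun_sum _ fun j _ => hmeas j) hfin.ne] with ω hω
  refine ⟨hω, fun hcont => ?_⟩
  intro s hs t ht hst hδ
  rw [mul_assoc, mul_assoc]
  refine EuclideanSpace.norm_le_card_mul _ fun j => ?_
  have hcj : ContinuousOn (fun t : ℝ => W j t.toNNReal ω) (Icc 0 T) :=
    (EuclideanSpace.proj (𝕜 := ℝ) j).continuous.comp_continuousOn hcont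
  have hle : dyadicEnergy r p T (fun t => W j t.toNNReal ω) ≤
      ENNReal.ofReal (∑ j, dyadicEnergy r p T (fun t => W j t.toNNReal ω)).toReal := by
    rw [ENNReal.ofReal_toReal hω.ne]
    exact Finset.single_le_sum (f := fun j => dyadicEnergy r p T (fun t => W j t.toNNReal ω))
      (fun _ _ => zero_le) (Finset.mem_univ j)
  have := holderAtScale_of_dyadicEnergy_le hT hr hp ENNReal.toReal_nonneg hcj hle s hs t ht hst hδ
  rw [mul_assoc] at this
  exact this

/-! ### Conclusion: moments of the solution -/

theorem IsReflectedSolution.continuousOn_noise {d m : ℕ} {T : ℝ} {x₀ : EuclideanSpace ℝ (Fin d)}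
    {b : ℝ → EuclideanSpace ℝ (Fin d) → EuclideanSpace ℝ (Fin d)}
    {σ : ℝ → EuclideanSpace ℝ (Fin d) → Matrix (Fin d) (Fin m) ℝ}
    {g : ℝ → EuclideanSpace ℝ (Fin m)} {x : ℝ → EuclideanSpace ℝ (Fin d)}
    (h : IsReflectedSolution T x₀ b σ g x) : ContinuousOn g (Icc 0 T) := by
  obtain ⟨-, J, z, y, hYoung, -⟩ := h
  obtain ⟨κ, -, γ, hγ, -, -, hg⟩ := hYoung.regular
  exact (holderAtScale_of_holderNormOn_lt_top hγ.1 hg).continuousOn hγ.1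

/-- A polynomial in a small power of `v` grows at most linearly. -/
theorem rpow_cube_one_add_le {A C v p q : ℝ} (hA : 0 ≤ A) (hC : 0 ≤ C) (hv : 0 ≤ v) (hp : 0 ≤ p)
    (hq : 0 < q) (hpq : 3 * p ≤ q) :
    (A * (1 + C * v ^ (1 / q)) ^ 3) ^ p ≤ (A * (1 + C) ^ 3) ^ p * (1 + v) := by
  have h1 : v ^ (1 / q) ≤ (1 + v) ^ (1 / q) :=
    Real.rpow_le_rpow hv (by linarith) (by positivity)
  have h2 : 1 ≤ (1 + v) ^ (1 / q) := Real.one_le_rpow (by linarith) (by positivity)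
  have h3 : 1 + C * v ^ (1 / q) ≤ (1 + C) * (1 + v) ^ (1 / q) := by
    rw [add_mul, one_mul]
    exact add_le_add h2 (by gcongr)
  calc (A * (1 + C * v ^ (1 / q)) ^ 3) ^ p
      ≤ (A * ((1 + C) * (1 + v) ^ (1 / q)) ^ 3) ^ p := by gcongr
    _ = (A * (1 + C) ^ 3) ^ p * (1 + v) ^ (1 / q * 3 * p) := by
        rw [mul_pow, ← mul_assoc, Real.mul_rpow (by positivity) (by positivity),
          ← Real.rpow_natCast ((1 + v) ^ (1 / q)), ← Real.rpow_mul (by positivity),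
          ← Real.rpow_mul (by positivity)]
        push_cast
        rw [mul_assoc (1 / q)]
    _ ≤ (A * (1 + C) ^ 3) ^ p * (1 + v) := by
        gcongr
        have : 1 / q * 3 * p ≤ 1 := by
          rw [show 1 / q * 3 * p = 3 * p / q by ring, div_le_one hq]; exact hpq
        simpa using Real.rpow_le_rpow_of_exponent_le (by linarith : 1 ≤ 1 + v) this

theorem theorem1 {Ω : Type*} [MeasurableSpace Ω] (P : Measure Ω) [IsProbabilityMeasure P]
    {d m : ℕ} (T H ν lam : ℝ) (hT : 0 < T) (hH : H ∈ Ioo (1 / 2 : ℝ) 1)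
    (hν : H ≤ ν) (hlam : lam ∈ Ioo (1 / 2 : ℝ) H)
    (W : Fin m → ℝ≥0 → Ω → ℝ)
    (hW : ∀ j, IsFractionalBrownianMotion P H (W j))
    (hW_indep : iIndepFun (fun j ω (t : ℝ≥0) => W j t ω) P)
    (x₀ : EuclideanSpace ℝ (Fin d)) (hx₀ : ∀ i, 0 < x₀ i)
    (b : ℝ → EuclideanSpace ℝ (Fin d) → EuclideanSpace ℝ (Fin d))
    (σ : ℝ → EuclideanSpace ℝ (Fin d) → Matrix (Fin d) (Fin m) ℝ)
    (hσ : HypSigma T ν σ) (hb : HypDrift T b)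
    (X : ℝ → Ω → EuclideanSpace ℝ (Fin d))
    (hX : IsStochasticReflectedSolution P T x₀ b σ W X) :
    AEMeasurable (fun ω => holderNormOn lam 0 T (fun t => X t ω)) P ∧
      ∀ p : ℝ, 1 ≤ p → ∫⁻ ω, holderNormOn lam 0 T (fun t => X t ω) ^ p ∂P < ∞ := by
  have hlam0 : 0 < lam := by linarith [hlam.1]
  have hgap : 0 < H - lam := by linarith [hlam.2]
  obtain ⟨A, hA, hbound⟩ := exists_holder_bound_of_isReflectedSolution hT hlam.1
    (by linarith [hlam.2, hH.2]) (by linarith [hlam.2] : lam ≤ ν) hσ hb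
  have hcontrol : ∀ q : ℝ, 0 < q → 1 < (H - lam) * q →
      ∃ (C : ℝ) (V : Ω → ℝ≥0∞), 0 ≤ C ∧ ∫⁻ ω, V ω ∂P < ∞ ∧ ∀ᵐ ω ∂P, V ω < ∞ ∧
        HolderAtScale lam T T (A * (1 + C * (V ω).toReal ^ (1 / q)) ^ 3) (fun t => X t ω) := by
    intro q hq hlq
    obtain ⟨C, V, hC, hV, hae⟩ :=
      exists_holder_control_noisePath hT (by linarith [hH.1]) hlam0 hq hlq hW
    refine ⟨C, V, hC, hV, ?_⟩
    filter_upwards [hae, hX.2] with ω hω hsol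
    exact ⟨hω.1, hbound x₀ _ _ _ (by positivity) (hω.2 hsol.continuousOn_noise) hsol⟩
  have hbig : 1 < (H - lam) * (2 / (H - lam)) := by
    rw [mul_div_cancel₀ _ hgap.ne']; norm_num
  constructor
  · obtain ⟨C, V, -, -, hae⟩ := hcontrol (2 / (H - lam)) (by positivity) hbig
    refine aemeasurable_holderNormOn hT hX.1 ?_
    filter_upwards [hae] with ω hω using hω.2.continuousOn hlam0
  · intro p hp
    -- `3 * p` absorbs the cube and the `p`-th power; `2 / (H - lam)` makes the dyadic energy
    -- integrable.
    set q : ℝ := max (3 * p) (2 / (H - lam)) with hq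
    have hq0 : 0 < q := lt_max_of_lt_left (by linarith)
    obtain ⟨C, V, hC, hV, hae⟩ := hcontrol q hq0
      (hbig.trans_le (mul_le_mul_of_nonneg_left (le_max_right _ _) hgap.le))
    have hle : ∀ᵐ ω ∂P, holderNormOn lam 0 T (fun t => X t ω) ^ p ≤
        ENNReal.ofReal ((A * (1 + C) ^ 3) ^ p) * (1 + V ω) := by
      filter_upwards [hae] with ω hω
      have hpoly := rpow_cube_one_add_le hA hC (ENNReal.toReal_nonneg (a := V ω))
        (by linarith : 0 ≤ p) hq0 (le_max_left _ _)
      calc holderNormOn lam 0 T (fun t => X t ω) ^ p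
          ≤ ENNReal.ofReal (A * (1 + C * (V ω).toReal ^ (1 / q)) ^ 3) ^ p :=
            ENNReal.rpow_le_rpow hω.2.holderNormOn_le (by linarith)
        _ = ENNReal.ofReal ((A * (1 + C * (V ω).toReal ^ (1 / q)) ^ 3) ^ p) :=
            ENNReal.ofReal_rpow_of_nonneg (by positivity) (by linarith)
        _ ≤ ENNReal.ofReal ((A * (1 + C) ^ 3) ^ p * (1 + (V ω).toReal)) :=
            ENNReal.ofReal_le_ofReal hpoly
        _ = ENNReal.ofReal ((A * (1 + C) ^ 3) ^ p) * (1 + V ω) := by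
            rw [ENNReal.ofReal_mul (by positivity), ENNReal.ofReal_add zero_le_one
              ENNReal.toReal_nonneg, ENNReal.ofReal_one, ENNReal.ofReal_toReal hω.1.ne]
    refine (lintegral_mono_ae hle).trans_lt ?_
    rw [lintegral_const_mul' _ _ ENNReal.ofReal_ne_top, lintegral_add_left measurable_const]
    refine ENNReal.mul_lt_top ENNReal.ofReal_lt_top (ENNReal.add_lt_top.2 ⟨?_, hV⟩)
    simp
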